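/- Let $\mathbb{F}_q$ be a finite field and let $n,k,\ell$ be positive integers with $k<n$ and $\min\{k,n-k\}\ge 3$. Let $\alpha_1,\dots,\alpha_n\in\mathbb{F}_q$ be distinct, and let $t=(t_1,\dots,t_\ell)\in\{1,\dots,n-k\}^\ell$ and $h=(h_1,\dots,h_\ell)\in\{0,\dots,k-1\}^\ell$ be such that the pairs $(h_j,t_j)$ are pairwise distinct. For $\eta\in\mathbb{F}_q^\ell$ let $$\mathcal{P}_\eta=\Big\{\sum_{i=0}^{k-1}f_iX^i+\sum_{j=1}^{\ell}\eta_j f_{h_j}X^{k-1+t_j}\ :\ f_0,\dots,f_{k-1}\in\mathbb{F}_q\Big\},$$ and let the twisted Reed--Solomon code with coefficient vector $\eta$ be $$\mathcal{C}_\eta=\{(f(\alpha_1),\dots,f(\alpha_n)) : f\in\mathcal{P}_\eta\}\subseteq\mathbb{F}_q^n .$$ A linear code of length $n$, dimension $k'$ and minimum Hamming distance $d$ is called MDS if $d=n-k'+1$. A code $\mathcal{C}\subseteq\mathbb{F}_q^n$ is called GRS if there are an integer $0\le k'\le n$, distinct $\beta_1,\dots,\beta_n\in\mathbb{F}_q$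 and nonzero $v_1,\dots,v_n\in\mathbb{F}_q$ with $\mathcal{C}=\{(v_1f(\beta_1),\dots,v_nf(\beta_n)) : f\in\mathbb{F}_q[X],\ \deg f<k'\}$ (with $\deg 0=-\infty$). Let $\mathcal{H}\subseteq\mathbb{F}_q^\ell$ be the set of all $\eta$ for which $\mathcal{C}_\eta$ is MDS, and assume that there is an $\eta^*\in\mathcal{H}$ for which $\mathcal{C}_{\eta^*}$ is not GRS. Then there is a nonzero polynomial $P\in\mathbb{F}_q[X_1,\dots,X_\ell]$, of degree at most $6$ in each variable, such that $P(\eta)=0$ for every $\eta\in\mathcal{H}$ for which $\mathcal{C}_\eta$ is GRS. -/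

import Mathlib

noncomputable section

namespace TwistedRS

open Polynomial

/-- The evaluation map `f ↦ [f(α₁), …, f(αₙ)]`. -/
def evalMap {F : Type*} [Field F] {n : ℕ} (α : Fin n → F) : F[X] →ₗ[F] (Fin n → F) :=
  LinearMap.pi fun i => Polynomial.leval (α i)

/-- The polynomial `∑_{i<k} fᵢ Xⁱ + ∑ⱼ ηⱼ f_{hⱼ} X^{k-1+tⱼ}` with coefficient vector `f`. -/
def twistedPoly {F : Type*} [Field F] {k ℓ : ℕ} (t : Fin ℓ → ℕ) (h : Fin ℓ → Fin k)
    (η : Fin ℓ → F) (f : Fin k → F) : F[X] :=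
  ∑ i : Fin k, C (f i) * X ^ (i : ℕ) + ∑ j : Fin ℓ, C (η j * f (h j)) * X ^ (k - 1 + t j)

/-- The space of twisted polynomials with twist vector `t`, hook vector `h` and
coefficient vector `η`. -/
def twistedPolynomials {F : Type*} [Field F] {k ℓ : ℕ} (t : Fin ℓ → ℕ) (h : Fin ℓ → Fin k)
    (η : Fin ℓ → F) : Submodule F F[X] where
  carrier := {p | ∃ f : Fin k → F, p = twistedPoly t h η f}
  zero_mem' := ⟨0, by simp [twistedPoly]⟩
  add_mem' := by
    rintro _ _ ⟨f, rfl⟩ ⟨g, rfl⟩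
    refine ⟨f + g, ?_⟩
    simp only [twistedPoly, Pi.add_apply, mul_add, map_add, add_mul, Finset.sum_add_distrib]
    ring
  smul_mem' := by
    rintro c _ ⟨f, rfl⟩
    refine ⟨c • f, ?_⟩
    simp only [twistedPoly, Polynomial.smul_eq_C_mul, Pi.smul_apply, smul_eq_mul, mul_add,
      Finset.mul_sum, map_mul]
    congr 1 <;> refine Finset.sum_congr rfl fun i _ => ?_ <;> ring

/-- The twisted Reed--Solomon code: the evaluations at `α` of the twisted polynomials. -/
def twistedRSCode {F : Type*} [Field F] {n k ℓ : ℕ} (α : Fin n → F) (t : Fin ℓ → ℕ)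
    (h : Fin ℓ → Fin k) (η : Fin ℓ → F) : Submodule F (Fin n → F) :=
  (twistedPolynomials t h η).map (evalMap α)

/-- `ev_β(F[X]_{<k}) · diag(v₁, …, vₙ)`. -/
def grsCode {F : Type*} [Field F] {n : ℕ} (k : ℕ) (β v : Fin n → F) :
    Submodule F (Fin n → F) :=
  ((Polynomial.degreeLT F k).map (evalMap β)).map (Matrix.vecMulLinear (Matrix.diagonal v))

/-- A linear code is a generalized Reed--Solomon code if it is given by some distinct evaluation
points and some nonzero column multipliers. -/
def IsGRS {F : Type*} [Field F] {n : ℕ} (𝒞 : Submodule F (Fin n → F)) : Prop :=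
  ∃ k : ℕ, k ≤ n ∧ ∃ β v : Fin n → F,
    Function.Injective β ∧ (∀ i, v i ≠ 0) ∧ 𝒞 = grsCode k β v

/-- The minimum Hamming distance between distinct codewords. -/
def minDist {F : Type*} [Field F] [DecidableEq F] {n : ℕ} (𝒞 : Submodule F (Fin n → F)) : ℕ :=
  sInf {d | ∃ x ∈ 𝒞, ∃ y ∈ 𝒞, x ≠ y ∧ hammingDist x y = d}

/-- A linear code is MDS if it meets the Singleton bound, `d = n - dim + 1`. -/
def IsMDS {F : Type*} [Field F] [DecidableEq F] {n : ℕ} (𝒞 : Submodule F (Fin n → F)) : Prop :=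
  minDist 𝒞 = n - Module.finrank F 𝒞 + 1

end TwistedRS

end

/-!
An MDS code has a generator matrix `(I ∣ A)` with `A` superregular. By Lagrange interpolation it
is GRS exactly when `A` is a generalized Cauchy matrix `a i * b j / (y j - x i)`, that is, when the
entrywise inverse of `A` has the entries `c i * d j * (y j - x i)`. Those are the `2 × 2`
determinants formed by one vector per row and one vector per column, and every matrix of rank two is
of this shape; the vectors are pairwise independent by superregularity, and as there are at most
`|F|` of them, a change of coordinates gives all of them finite slopes. So the code is GRS exactly
when the `3 × 3` minors of the entrywise inverse that border a fixed `2 × 2` minor vanish.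

For the twisted codes, each `η j` occurs in a single row of a generator matrix, to the first power.
By Cramer's rule, `A` has entries of degree one in `η j` up to a common factor, and clearing the
denominators of a bordering minor gives a polynomial of degree six in these entries. One that does
not vanish at `η*` is the required polynomial.
-/

namespace TwistedRS

open Polynomial

section ProjectiveLine

variable {F σ : Type*}

theorem not_surjective_option_of_injective [Finite σ] {g : σ → F} (hg : Function.Injective g)
    (φ : σ → Option F) : ¬ Function.Surjective φ := by
  intro hφ
  have := Finite.of_surjective φ hφ
  have := Finite.of_injective _ (Option.some_injective F)
  have h₁ := Nat.card_le_card_of_surjective φ hφ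
  have h₂ := Nat.card_le_card_of_injective g hg
  rw [Finite.card_option] at h₁
  omega

variable [Field F]

/- The lines in the plane are indexed by `Option F`; as there are more of them than vectors, some
line contains none of the vectors, and a unimodular change of coordinates makes it `l = 0`. -/
theorem exists_unimodular_coords_ne_zero [Finite σ] {g : σ → F} (hg : Function.Injective g)
    {p q : σ → F} (hpq : ∀ a, p a ≠ 0 ∨ q a ≠ 0) :
    ∃ l r : σ → F, (∀ a, l a ≠ 0) ∧
      ∀ a b, l a * r b - l b * r a = p a * q b - p b * q a := by
  classical
  let slope : σ → Option F := fun a => if p a = 0 then none else some (-q a / p a)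
  obtain ⟨s, hs⟩ : ∃ s, ∀ a, slope a ≠ s := by
    simpa [Function.Surjective] using not_surjective_option_of_injective hg slope
  cases s with
  | none => exact ⟨p, q, fun a ha => hs a (if_pos ha), fun _ _ => rfl⟩
  | some c =>
    refine ⟨fun a => c * p a + q a, fun a => -p a, fun a ha => hs a ?_, fun a b => by ring⟩
    have hp : p a ≠ 0 := fun hp => (hpq a).elim (· hp) (· (by simpa [hp] using ha))
    simp only [slope, if_neg hp, Option.some.injEq, div_eq_iff hp]
    linear_combination -ha

theorem exists_injective_slopes [Finite σ] [Nontrivial σ] {g : σ → F} (hg : Function.Injective g)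
    {p q : σ → F} (hpq : Pairwise fun a b => p a * q b - p b * q a ≠ 0) :
    ∃ β l : σ → F, Function.Injective β ∧ (∀ a, l a ≠ 0) ∧
      ∀ a b, p a * q b - p b * q a = l a * l b * (β b - β a) := by
  have hne : ∀ a, p a ≠ 0 ∨ q a ≠ 0 := by
    intro a
    obtain ⟨b, hb⟩ := exists_ne a
    by_contra! hzero
    exact hpq hb.symm (by simp [hzero])
  obtain ⟨l, r, hl, hlr⟩ := exists_unimodular_coords_ne_zero hg hne
  have hslope : ∀ a b, p a * q b - p b * q a = l a * l b * (r b / l b - r a / l a) := by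
    intro a b
    have := hl a
    have := hl b
    rw [← hlr]
    field_simp
  refine ⟨fun a => r a / l a, l, fun a b hab => ?_, hl, hslope⟩
  by_contra hab'
  exact hpq hab' (by rw [hslope, sub_eq_zero.2 hab.symm, mul_zero])

end ProjectiveLine

section GeneralizedCauchy

variable {F ι κ : Type*} [Field F]

/-- The generalized Cauchy matrix with nodes `β` and scaling factors `l`; the left summand of the
index type `ι ⊕ κ` refers to the rows and the right one to the columns. -/
def generalizedCauchy (β l : ι ⊕ κ → F) : Matrix ι κ F :=
  Matrix.of fun i j => l (.inl i) * l (.inr j) / (β (.inr j) - β (.inl i))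

/-- A matrix is generalized Cauchy if it comes from distinct nodes and nonzero scaling factors. -/
def IsGeneralizedCauchy (A : Matrix ι κ F) : Prop :=
  ∃ β l : ι ⊕ κ → F, Function.Injective β ∧ (∀ a, l a ≠ 0) ∧ A = generalizedCauchy β l

/-- A matrix is superregular if all its square submatrices are nonsingular. These are the
non-systematic parts of the generator matrices of MDS codes. -/
def IsSuperregular (A : Matrix ι κ F) : Prop :=
  ∀ (s : ℕ) (e : Fin s → ι) (f : Fin s → κ), Function.Injective e → Function.Injective f →
    (A.submatrix e f).det ≠ 0

theorem IsSuperregular.apply_ne_zero {A : Matrix ι κ F} (hA : IsSuperregular A) (i : ι) (j : κ) :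
    A i j ≠ 0 := by
  have hdet := hA 1 ![i] ![j] (Function.injective_of_subsingleton _)
    (Function.injective_of_subsingleton _)
  rwa [Matrix.det_fin_one] at hdet

theorem IsSuperregular.inv_minor_two_ne_zero {A : Matrix ι κ F} (hA : IsSuperregular A) {i i' : ι}
    (hi : i ≠ i') {j j' : κ} (hj : j ≠ j') :
    (A i j)⁻¹ * (A i' j')⁻¹ - (A i j')⁻¹ * (A i' j)⁻¹ ≠ 0 := by
  have hdet := hA 2 ![i, i'] ![j, j'] (by simpa using hi) (by simpa using hj)
  rw [Matrix.det_fin_two] at hdet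
  rw [← mul_inv, ← mul_inv, sub_ne_zero, inv_injective.ne_iff, ← sub_ne_zero]
  exact hdet

theorem exists_eq_plane_det_of_bordered_minors {B : Matrix ι κ F} {i₀ i₁ : ι} {j₀ j₁ : κ}
    (hminor : B i₀ j₀ * B i₁ j₁ - B i₀ j₁ * B i₁ j₀ ≠ 0)
    (hdet : ∀ i j, (B.submatrix ![i₀, i₁, i] ![j₀, j₁, j]).det = 0) :
    ∃ p q : ι ⊕ κ → F, ∀ i j, B i j = p (.inl i) * q (.inr j) - p (.inr j) * q (.inl i) := by
  let d := B i₀ j₀ * B i₁ j₁ - B i₀ j₁ * B i₁ j₀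
  refine ⟨Sum.elim (B · j₀) fun j => (B i₀ j * B i₁ j₀ - B i₀ j₀ * B i₁ j) / d,
    Sum.elim (B · j₁) fun j => (B i₀ j * B i₁ j₁ - B i₀ j₁ * B i₁ j) / d, fun i j => ?_⟩
  have hij := hdet i j
  simp only [Matrix.det_fin_three, Matrix.submatrix_apply, Matrix.cons_val] at hij
  rw [Sum.elim_inl, Sum.elim_inl, Sum.elim_inr, Sum.elim_inr, mul_div_assoc', div_mul_eq_mul_div,
    ← sub_div, eq_div_iff hminor]
  linear_combination hij

/- Two rows (or columns) give independent vectors, because by the Plücker relation the product of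
their determinant with that of two columns (or rows) is a `2 × 2` minor of the inverse matrix. -/
theorem IsSuperregular.pairwise_plane_det_ne_zero [Nontrivial ι] [Nontrivial κ] {A : Matrix ι κ F}
    (hA : IsSuperregular A) {p q : ι ⊕ κ → F}
    (hpq : ∀ i j, (A i j)⁻¹ = p (.inl i) * q (.inr j) - p (.inr j) * q (.inl i)) :
    Pairwise fun a b => p a * q b - p b * q a ≠ 0 := by
  have hmixed (i : ι) (j : κ) : p (.inl i) * q (.inr j) - p (.inr j) * q (.inl i) ≠ 0 := by
    rw [← hpq]
    exact inv_ne_zero (hA.apply_ne_zero i j)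
  have hplucker {i i' : ι} (hi : i ≠ i') {j j' : κ} (hj : j ≠ j') :
      (p (.inl i) * q (.inl i') - p (.inl i') * q (.inl i)) *
        (p (.inr j) * q (.inr j') - p (.inr j') * q (.inr j)) ≠ 0 := by
    refine ne_of_eq_of_ne ?_ (hA.inv_minor_two_ne_zero hi hj)
    simp only [hpq]
    ring
  obtain ⟨i₀, i₁, hi⟩ := exists_pair_ne ι
  obtain ⟨j₀, j₁, hj⟩ := exists_pair_ne κ
  rintro (i | j) (i' | j') hne
  · exact left_ne_zero_of_mul (hplucker (fun h => hne (congrArg _ h)) hj)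
  · exact hmixed i j'
  · rw [← neg_sub]
    exact neg_ne_zero.2 (hmixed i' j)
  · exact right_ne_zero_of_mul (hplucker hi fun h => hne (congrArg _ h))

theorem IsSuperregular.isGeneralizedCauchy [Finite ι] [Finite κ] {A : Matrix ι κ F}
    (hA : IsSuperregular A) {g : ι ⊕ κ → F} (hg : Function.Injective g)
    {i₀ i₁ : ι} (hi : i₀ ≠ i₁) {j₀ j₁ : κ} (hj : j₀ ≠ j₁)
    (hdet : ∀ i j, ((A.map (·⁻¹)).submatrix ![i₀, i₁, i] ![j₀, j₁, j]).det = 0) :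
    IsGeneralizedCauchy A := by
  have : Nontrivial ι := ⟨i₀, i₁, hi⟩
  have : Nontrivial κ := ⟨j₀, j₁, hj⟩
  have : Nontrivial (ι ⊕ κ) := Sum.inl_injective.nontrivial
  obtain ⟨p, q, hpq⟩ := exists_eq_plane_det_of_bordered_minors
    (hA.inv_minor_two_ne_zero hi hj) hdet
  obtain ⟨β, l, hβ, hl, hβl⟩ := exists_injective_slopes hg (hA.pairwise_plane_det_ne_zero hpq)
  refine ⟨β, fun a => (l a)⁻¹, hβ, fun a => inv_ne_zero (hl a), ?_⟩
  ext i j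
  have hinv : (A i j)⁻¹ = l (.inl i) * l (.inr j) * (β (.inr j) - β (.inl i)) :=
    (hpq i j).trans (hβl _ _)
  rw [← inv_inv (A i j), hinv, generalizedCauchy, Matrix.of_apply, mul_inv, mul_inv,
    div_eq_mul_inv]

theorem IsGeneralizedCauchy.det_map_inv_eq_zero {A : Matrix ι κ F} (hA : IsGeneralizedCauchy A)
    (e : Fin 3 → ι) (f : Fin 3 → κ) : ((A.map (·⁻¹)).submatrix e f).det = 0 := by
  obtain ⟨β, l, -, -, rfl⟩ := hA
  simp only [Matrix.det_fin_three, Matrix.submatrix_apply, Matrix.map_apply, generalizedCauchy,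
    Matrix.of_apply, inv_div]
  ring

end GeneralizedCauchy

section InverseMinor

variable {R : Type*} [CommRing R]

/-- The determinant of the entrywise inverse of a `3 × 3` matrix, multiplied by the product of all
nine entries: this clears the denominators, and leaves a polynomial in the entries. -/
def inverseMinor (M : Matrix (Fin 3) (Fin 3) R) : R :=
  (Matrix.of fun i j => M i (j + 1) * M i (j + 2)).det

theorem map_inverseMinor {S : Type*} [CommRing S] (f : R →+* S) (M : Matrix (Fin 3) (Fin 3) R) :
    f (inverseMinor M) = inverseMinor (M.map f) := by
  rw [inverseMinor, RingHom.map_det, inverseMinor]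
  congr 1
  ext i j
  simp

theorem inverseMinor_smul (c : R) (M : Matrix (Fin 3) (Fin 3) R) :
    inverseMinor (c • M) = c ^ 6 * inverseMinor M := by
  have hsmul : (Matrix.of fun i j => (c • M) i (j + 1) * (c • M) i (j + 2)) =
      c ^ 2 • Matrix.of fun i j => M i (j + 1) * M i (j + 2) := by
    ext i j
    simp only [Matrix.of_apply, Matrix.smul_apply, smul_eq_mul]
    ring
  rw [inverseMinor, hsmul, Matrix.det_smul, Fintype.card_fin, ← pow_mul, inverseMinor]

theorem inverseMinor_eq_prod_mul_det {F : Type*} [Field F] {M : Matrix (Fin 3) (Fin 3) F}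
    (hM : ∀ i j, M i j ≠ 0) : inverseMinor M = (∏ i, ∏ j, M i j) * (M.map (·⁻¹)).det := by
  have hrow : ∀ i j, M i (j + 1) * M i (j + 2) = (∏ j, M i j) * (M i j)⁻¹ := by
    intro i j
    rw [eq_mul_inv_iff_mul_eq₀ (hM i j), Fin.prod_univ_three]
    fin_cases j <;> simp <;> ring
  rw [inverseMinor, ← Matrix.det_mul_column]
  exact congrArg _ (Matrix.ext hrow)

theorem inverseMinor_eq_zero_iff {F : Type*} [Field F] {M : Matrix (Fin 3) (Fin 3) F}
    (hM : ∀ i j, M i j ≠ 0) : inverseMinor M = 0 ↔ (M.map (·⁻¹)).det = 0 := by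
  rw [inverseMinor_eq_prod_mul_det hM, mul_eq_zero, or_iff_right]
  exact Finset.prod_ne_zero_iff.2 fun i _ => Finset.prod_ne_zero_iff.2 fun j _ => hM i j

end InverseMinor

section RowSpace

variable {F : Type*} [Field F] {n k r : ℕ}

/-- The code generated by the rows of a matrix. -/
def rowSpace {ι : Type*} [Fintype ι] (G : Matrix ι (Fin n) F) : Submodule F (Fin n → F) :=
  LinearMap.range G.vecMulLinear

theorem mem_rowSpace {ι : Type*} [Fintype ι] {G : Matrix ι (Fin n) F} {x : Fin n → F} :
    x ∈ rowSpace G ↔ ∃ u, Matrix.vecMul u G = x :=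
  Iff.rfl

theorem finrank_rowSpace {ι : Type*} [Fintype ι] {G : Matrix ι (Fin n) F}
    (hG : Function.Injective G.vecMul) : Module.finrank F (rowSpace G) = Fintype.card ι := by
  rw [rowSpace, LinearMap.finrank_range_of_inj hG, Module.finrank_fintype_fun_eq_card]

/-- The code with systematic generator matrix `(I ∣ A)`. -/
def systematicCode (A : Matrix (Fin k) (Fin r) F) : Submodule F (Fin (k + r) → F) :=
  rowSpace (Matrix.of fun i => Fin.append (Pi.single i 1) (A i))

theorem vecMul_systematicGenerator (A : Matrix (Fin k) (Fin r) F) (u : Fin k → F) :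
    Matrix.vecMul u (Matrix.of fun i => Fin.append (Pi.single i 1) (A i)) =
      Fin.append u (Matrix.vecMul u A) := by
  ext m
  cases m using Fin.addCases <;> simp [Matrix.vecMul, dotProduct, Pi.single_apply]

theorem append_vecMul_mem_systematicCode (A : Matrix (Fin k) (Fin r) F) (u : Fin k → F) :
    Fin.append u (Matrix.vecMul u A) ∈ systematicCode A :=
  ⟨u, vecMul_systematicGenerator A u⟩

theorem mem_systematicCode {A : Matrix (Fin k) (Fin r) F} {x : Fin (k + r) → F} :
    x ∈ systematicCode A ↔
      ∀ j, x (Fin.natAdd k j) = ∑ i, x (Fin.castAdd r i) * A i j := by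
  constructor
  · rintro ⟨u, rfl⟩ j
    rw [Matrix.vecMulLinear_apply, vecMul_systematicGenerator, Fin.append_right]
    simp [Matrix.vecMul, dotProduct]
  · intro hx
    convert append_vecMul_mem_systematicCode A fun i => x (Fin.castAdd r i)
    ext m
    cases m using Fin.addCases <;> simp [Matrix.vecMul, dotProduct, hx]

theorem finrank_systematicCode (A : Matrix (Fin k) (Fin r) F) :
    Module.finrank F (systematicCode A) = k := by
  refine (finrank_rowSpace fun u w huw => funext fun i => ?_).trans (Fintype.card_fin k)
  simpa [vecMul_systematicGenerator] using congrFun huw (Fin.castAdd r i)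

theorem systematicCode_injective :
    Function.Injective (systematicCode : Matrix (Fin k) (Fin r) F → _) := by
  intro A B hAB
  ext i j
  have hrow := append_vecMul_mem_systematicCode A (Pi.single i 1)
  rw [hAB, mem_systematicCode] at hrow
  simpa [Pi.single_apply] using hrow j

/-- The square block of the first `k` columns of a generator matrix. -/
def leadingBlock {R : Type*} (G : Matrix (Fin k) (Fin (k + r)) R) : Matrix (Fin k) (Fin k) R :=
  G.submatrix id (Fin.castAdd r)

/-- The block of the columns of a generator matrix that follow the leading block. -/
def trailingBlock {R : Type*} (G : Matrix (Fin k) (Fin (k + r)) R) : Matrix (Fin k) (Fin r) R :=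
  G.submatrix id (Fin.natAdd k)

theorem rowSpace_eq_systematicCode {G : Matrix (Fin k) (Fin (k + r)) F}
    (hG : IsUnit (leadingBlock G).det) :
    rowSpace G = systematicCode ((leadingBlock G)⁻¹ * trailingBlock G) := by
  have hblocks : ∀ u, Matrix.vecMul u G = Fin.append (Matrix.vecMul u (leadingBlock G))
      (Matrix.vecMul u (trailingBlock G)) := fun u => Fin.append_castAdd_natAdd.symm
  apply le_antisymm
  · rintro _ ⟨u, rfl⟩
    have hmem := append_vecMul_mem_systematicCode ((leadingBlock G)⁻¹ * trailingBlock G)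
      (Matrix.vecMul u (leadingBlock G))
    rwa [Matrix.vecMul_vecMul, Matrix.mul_nonsing_inv_cancel_left _ _ hG, ← hblocks] at hmem
  · rintro _ ⟨u, rfl⟩
    refine ⟨Matrix.vecMul u (leadingBlock G)⁻¹, ?_⟩
    rw [Matrix.vecMulLinear_apply, Matrix.vecMulLinear_apply, hblocks, vecMul_systematicGenerator,
      Matrix.vecMul_vecMul, Matrix.vecMul_vecMul, Matrix.nonsing_inv_mul _ hG, Matrix.vecMul_one]

end RowSpace

section HammingNorm

variable {M ι κ : Type*} [Zero M] [DecidableEq M] [Fintype ι] [Fintype κ]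

theorem hammingNorm_append {k r : ℕ} (u : Fin k → M) (w : Fin r → M) :
    hammingNorm (Fin.append u w) = hammingNorm u + hammingNorm w := by
  simp only [hammingNorm, Finset.card_filter, Fin.sum_univ_add, Fin.append_left, Fin.append_right]

theorem hammingNorm_le_card_of_eq_zero {e : ι → κ} {x : κ → M}
    (hx : ∀ i ∉ Set.range e, x i = 0) : hammingNorm x ≤ Fintype.card ι := by
  classical
  refine (Finset.card_le_card fun i hi => ?_).trans (Finset.card_image_le (f := e))
  have hrange : i ∈ Set.range e := by_contra fun h => (Finset.mem_filter.1 hi).2 (hx i h)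
  simpa using hrange

theorem hammingNorm_add_card_le_of_eq_zero {e : ι → κ} (he : Function.Injective e) {x : κ → M}
    (hx : ∀ a, x (e a) = 0) : hammingNorm x + Fintype.card ι ≤ Fintype.card κ := by
  classical
  rw [← Finset.card_univ (α := ι), ← Finset.card_image_of_injective _ he, hammingNorm,
    ← Finset.card_union_of_disjoint]
  · exact Finset.card_le_univ _
  · rw [Finset.disjoint_left]
    simp only [Finset.mem_filter, Finset.mem_image, Finset.mem_univ, true_and, not_exists]
    rintro _ hi a rfl
    exact hi (hx a)

end HammingNorm

section MDS

variable {F : Type*} [Field F] [DecidableEq F] {n k r : ℕ}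

theorem IsMDS.lt_hammingNorm {𝒞 : Submodule F (Fin n → F)} (h𝒞 : IsMDS 𝒞) {x : Fin n → F}
    (hx : x ∈ 𝒞) (hx0 : x ≠ 0) : n - Module.finrank F 𝒞 < hammingNorm x := by
  have hdist : minDist 𝒞 ≤ hammingNorm x := Nat.sInf_le ⟨x, hx, 0, 𝒞.zero_mem, hx0, rfl⟩
  rw [h𝒞] at hdist
  exact hdist

theorem isUnit_det_leadingBlock {G : Matrix (Fin k) (Fin (k + r)) F}
    (hG : Function.Injective G.vecMul) (hmds : IsMDS (rowSpace G)) :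
    IsUnit (leadingBlock G).det := by
  rw [isUnit_iff_ne_zero]
  intro hdet
  obtain ⟨u, hu, hu0⟩ := Matrix.exists_vecMul_eq_zero_iff.2 hdet
  have hweight := hmds.lt_hammingNorm (mem_rowSpace.2 ⟨u, rfl⟩)
    fun h => hu (hG (h.trans (Matrix.zero_vecMul G).symm))
  have hword : Matrix.vecMul u G = Fin.append 0 (Matrix.vecMul u (trailingBlock G)) := by
    rw [← hu0]
    exact Fin.append_castAdd_natAdd.symm
  have hle := hammingNorm_le_card_fintype (x := Matrix.vecMul u (trailingBlock G))
  rw [finrank_rowSpace hG, hword, hammingNorm_append, hammingNorm_zero] at hweight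
  simp only [Fintype.card_fin] at hweight hle
  omega

/- A row dependency in an `s × s` submatrix gives a codeword with at most `s` nonzero entries among
the first `k` and at least `s` zeros among the remaining ones. -/
theorem IsMDS.isSuperregular {A : Matrix (Fin k) (Fin r) F} (hA : IsMDS (systematicCode A)) :
    IsSuperregular A := by
  intro s e f he hf hdet
  obtain ⟨w, hw, hw0⟩ := Matrix.exists_vecMul_eq_zero_iff.2 hdet
  let u : Fin k → F := Function.extend e w 0
  have hu : ∀ a, u (e a) = w a := fun a => he.extend_apply w 0 a
  have hu_off : ∀ i ∉ Set.range e, u i = 0 := fun i hi => Function.extend_apply' w _ i hi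
  have huA : ∀ c, Matrix.vecMul u A (f c) = 0 := by
    intro c
    refine Eq.trans ?_ (congrFun hw0 c)
    refine (Fintype.sum_of_injective e he _ _ (fun i hi => ?_) fun a => ?_).symm
    · rw [hu_off i hi, zero_mul]
    · simp only [hu, Matrix.submatrix_apply]
  have hne : Fin.append u (Matrix.vecMul u A) ≠ 0 := fun h => hw <| funext fun a => by
    simpa [hu] using congrFun h (Fin.castAdd r (e a))
  have hweight := hA.lt_hammingNorm (append_vecMul_mem_systematicCode A u) hne
  have hleft : hammingNorm u ≤ s := by
    simpa using hammingNorm_le_card_of_eq_zero hu_off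
  have hright : hammingNorm (Matrix.vecMul u A) + s ≤ r := by
    simpa using hammingNorm_add_card_le_of_eq_zero hf huA
  rw [finrank_systematicCode, hammingNorm_append] at hweight
  omega

end MDS

section GRS

variable {F : Type*} [Field F] {n k r : ℕ}

theorem injOn_evalMap {α : Fin n → F} (hα : Function.Injective α) :
    Set.InjOn (evalMap α) (degreeLT F n : Set F[X]) := by
  intro p hp q hq hpq
  refine eq_of_degrees_lt_of_eval_index_eq Finset.univ hα.injOn ?_ ?_ fun m _ => congrFun hpq m
  · simpa [mem_degreeLT] using hp
  · simpa [mem_degreeLT] using hq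

theorem mem_grsCode {β v x : Fin n → F} :
    x ∈ grsCode k β v ↔ ∃ f ∈ degreeLT F k, ∀ m, x m = f.eval (β m) * v m := by
  simp only [grsCode, Submodule.mem_map, exists_exists_and_eq_and, funext_iff (f := x),
    eq_comm (b := x), Matrix.vecMulLinear_apply, Matrix.vecMul_diagonal, evalMap,
    LinearMap.pi_apply, leval_apply]

theorem finrank_grsCode (hk : k ≤ n) {β v : Fin n → F} (hβ : Function.Injective β)
    (hv : ∀ m, v m ≠ 0) : Module.finrank F (grsCode k β v) = k := by
  let encode := (Matrix.diagonal v).vecMulLinear ∘ₗ evalMap β ∘ₗ (degreeLT F k).subtype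
  have hinj : Function.Injective encode := by
    rintro ⟨p, hp⟩ ⟨q, hq⟩ hpq
    refine Subtype.ext (injOn_evalMap hβ (degreeLT_mono hk hp) (degreeLT_mono hk hq) ?_)
    ext m
    simpa [encode, Matrix.vecMul_diagonal, hv] using congrFun hpq m
  have hrange : LinearMap.range encode = grsCode k β v := by
    rw [LinearMap.range_comp, LinearMap.range_comp, Submodule.range_subtype, grsCode]
  rw [← hrange, LinearMap.finrank_range_of_inj hinj, (degreeLTEquiv F k).finrank_eq,
    Module.finrank_fin_fun]

variable {β v l : Fin k ⊕ Fin r → F}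

theorem eval_nodal_inr_ne_zero (hβ : Function.Injective β) (j : Fin r) :
    (Lagrange.nodal Finset.univ (β ∘ Sum.inl)).eval (β (.inr j)) ≠ 0 :=
  Lagrange.eval_nodal_not_at_node fun _ _ => hβ.ne Sum.inr_ne_inl

/- This is the first barycentric form of Lagrange interpolation at the first `k` nodes. -/
theorem grsCode_eq_systematicCode (hβ : Function.Injective β) (hv : ∀ a, v a ≠ 0)
    (hrow : ∀ i, l (.inl i) * v (.inl i) = Lagrange.nodalWeight Finset.univ (β ∘ Sum.inl) i)
    (hcol : ∀ j, l (.inr j) =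
      (Lagrange.nodal Finset.univ (β ∘ Sum.inl)).eval (β (.inr j)) * v (.inr j)) :
    grsCode k (β ∘ finSumFinEquiv.symm) (v ∘ finSumFinEquiv.symm) =
      systematicCode (generalizedCauchy β l) := by
  refine Submodule.eq_of_le_of_finrank_eq (fun x hx => mem_systematicCode.2 fun j => ?_)
    ((finrank_grsCode (Nat.le_add_right k r) (hβ.comp finSumFinEquiv.symm.injective)
      fun m => hv _).trans (finrank_systematicCode _).symm)
  obtain ⟨f, hf, hx⟩ := mem_grsCode.1 hx
  have hdeg : f.degree < (Finset.univ : Finset (Fin k)).card := by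
    rw [Finset.card_fin]
    exact mem_degreeLT.1 hf
  have hnode : ∀ i ∈ Finset.univ, β (.inr j) ≠ (β ∘ Sum.inl) i := fun _ _ => hβ.ne Sum.inr_ne_inl
  have hinterp := congrArg (eval (β (.inr j)))
    (Lagrange.eq_interpolate (hβ.comp Sum.inl_injective).injOn hdeg)
  rw [Lagrange.eval_interpolate_not_at_node _ hnode] at hinterp
  simp only [hx, Function.comp_apply, finSumFinEquiv_symm_apply_castAdd,
    finSumFinEquiv_symm_apply_natAdd]
  rw [hinterp, Finset.mul_sum, Finset.sum_mul]
  refine Finset.sum_congr rfl fun i _ => ?_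
  simp only [generalizedCauchy, Matrix.of_apply, Function.comp_apply, ← hrow, hcol]
  ring

theorem IsGeneralizedCauchy.isGRS {A : Matrix (Fin k) (Fin r) F} (hA : IsGeneralizedCauchy A) :
    IsGRS (systematicCode A) := by
  obtain ⟨β, l, hβ, hl, rfl⟩ := hA
  let v : Fin k ⊕ Fin r → F := Sum.elim
    (fun i => Lagrange.nodalWeight Finset.univ (β ∘ Sum.inl) i / l (.inl i))
    (fun j => l (.inr j) / (Lagrange.nodal Finset.univ (β ∘ Sum.inl)).eval (β (.inr j)))
  have hv : ∀ a, v a ≠ 0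
    | .inl i => div_ne_zero (Lagrange.nodalWeight_ne_zero (hβ.comp Sum.inl_injective).injOn
        (Finset.mem_univ i)) (hl _)
    | .inr j => div_ne_zero (hl _) (eval_nodal_inr_ne_zero hβ j)
  exact ⟨k, Nat.le_add_right k r, β ∘ finSumFinEquiv.symm, v ∘ finSumFinEquiv.symm,
    hβ.comp finSumFinEquiv.symm.injective, fun m => hv _,
    (grsCode_eq_systematicCode hβ hv (fun i => mul_div_cancel₀ _ (hl _))
      fun j => (mul_div_cancel₀ _ (eval_nodal_inr_ne_zero hβ j)).symm).symm⟩

theorem isGeneralizedCauchy_of_isGRS {A : Matrix (Fin k) (Fin r) F}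
    (hA : IsGRS (systematicCode A)) : IsGeneralizedCauchy A := by
  obtain ⟨k', hk', β', v', hβ', hv', hcode⟩ := hA
  obtain rfl : k = k' := by rw [← finrank_systematicCode A, hcode, finrank_grsCode hk' hβ' hv']
  obtain ⟨β, rfl⟩ : ∃ β, β ∘ finSumFinEquiv.symm = β' := ⟨β' ∘ finSumFinEquiv, by ext; simp⟩
  obtain ⟨v, rfl⟩ : ∃ v, v ∘ finSumFinEquiv.symm = v' := ⟨v' ∘ finSumFinEquiv, by ext; simp⟩
  have hβ : Function.Injective β := (Equiv.injective_comp _ _).1 hβ'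
  have hv : ∀ a, v a ≠ 0 := fun a => by simpa using hv' (finSumFinEquiv a)
  let l : Fin k ⊕ Fin r → F := Sum.elim
    (fun i => Lagrange.nodalWeight Finset.univ (β ∘ Sum.inl) i / v (.inl i))
    (fun j => (Lagrange.nodal Finset.univ (β ∘ Sum.inl)).eval (β (.inr j)) * v (.inr j))
  have hl : ∀ a, l a ≠ 0
    | .inl i => div_ne_zero (Lagrange.nodalWeight_ne_zero (hβ.comp Sum.inl_injective).injOn
        (Finset.mem_univ i)) (hv _)
    | .inr j => mul_ne_zero (eval_nodal_inr_ne_zero hβ j) (hv _)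
  refine ⟨β, l, hβ, hl, systematicCode_injective (hcode.trans ?_)⟩
  exact grsCode_eq_systematicCode hβ hv (fun i => div_mul_cancel₀ _ (hv _)) fun j => rfl

theorem isGRS_systematicCode_iff {A : Matrix (Fin k) (Fin r) F} :
    IsGRS (systematicCode A) ↔ IsGeneralizedCauchy A :=
  ⟨isGeneralizedCauchy_of_isGRS, IsGeneralizedCauchy.isGRS⟩

theorem IsSuperregular.isGRS_systematicCode_iff_inverseMinor {A : Matrix (Fin k) (Fin r) F}
    (hA : IsSuperregular A) {g : Fin (k + r) → F} (hg : Function.Injective g)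
    {i₀ i₁ : Fin k} (hi : i₀ ≠ i₁) {j₀ j₁ : Fin r} (hj : j₀ ≠ j₁) :
    IsGRS (systematicCode A) ↔
      ∀ i j, inverseMinor (A.submatrix ![i₀, i₁, i] ![j₀, j₁, j]) = 0 := by
  have hminor : ∀ i j, inverseMinor (A.submatrix ![i₀, i₁, i] ![j₀, j₁, j]) = 0 ↔
      ((A.map (·⁻¹)).submatrix ![i₀, i₁, i] ![j₀, j₁, j]).det = 0 := fun i j =>
    inverseMinor_eq_zero_iff fun _ _ => hA.apply_ne_zero _ _
  simp only [isGRS_systematicCode_iff, hminor]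
  exact ⟨fun h i j => h.det_map_inv_eq_zero _ _,
    hA.isGeneralizedCauchy (hg.comp finSumFinEquiv.injective) hi hj⟩

end GRS

section ClearedSystematicPart

variable {R S F : Type*} [CommRing R] [CommRing S] [Field F] {k r : ℕ}

/-- The matrix `det L • (L⁻¹ * T)` for a generator matrix with blocks `G = (L ∣ T)`: this is the
matrix `A` of the systematic generator matrix `(I ∣ A)`, up to the factor `det L` that makes its
entries polynomials in the entries of `G`. -/
def clearedSystematicPart (G : Matrix (Fin k) (Fin (k + r)) R) : Matrix (Fin k) (Fin r) R :=
  (leadingBlock G).adjugate * trailingBlock G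

theorem map_clearedSystematicPart (f : R →+* S) (G : Matrix (Fin k) (Fin (k + r)) R) :
    (clearedSystematicPart G).map f = clearedSystematicPart (G.map f) := by
  rw [clearedSystematicPart, Matrix.map_mul, ← RingHom.mapMatrix_apply f, RingHom.map_adjugate]
  rfl

theorem clearedSystematicPart_apply (G : Matrix (Fin k) (Fin (k + r)) R) (i : Fin k) (j : Fin r) :
    clearedSystematicPart G i j =
      ((leadingBlock G).updateCol i fun a => trailingBlock G a j).det := by
  rw [← Matrix.cramer_apply, Matrix.cramer_eq_adjugate_mulVec]
  rfl

theorem isGRS_rowSpace_iff [DecidableEq F] {G : Matrix (Fin k) (Fin (k + r)) F}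
    (hG : Function.Injective G.vecMul) (hmds : IsMDS (rowSpace G))
    {g : Fin (k + r) → F} (hg : Function.Injective g)
    {i₀ i₁ : Fin k} (hi : i₀ ≠ i₁) {j₀ j₁ : Fin r} (hj : j₀ ≠ j₁) :
    IsGRS (rowSpace G) ↔ ∀ i j,
      inverseMinor ((clearedSystematicPart G).submatrix ![i₀, i₁, i] ![j₀, j₁, j]) = 0 := by
  have hunit := isUnit_det_leadingBlock hG hmds
  have hscale : (leadingBlock G)⁻¹ * trailingBlock G =
      (leadingBlock G).det⁻¹ • clearedSystematicPart G := by
    rw [Matrix.inv_def, Ring.inverse_eq_inv', Matrix.smul_mul, clearedSystematicPart]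
  rw [rowSpace_eq_systematicCode hunit] at hmds ⊢
  rw [hmds.isSuperregular.isGRS_systematicCode_iff_inverseMinor hg hi hj, hscale]
  simp only [Matrix.submatrix_smul, Pi.smul_apply, inverseMinor_smul, mul_eq_zero, pow_eq_zero_iff,
    ne_eq, OfNat.ofNat_ne_zero, not_false_eq_true, inv_eq_zero, hunit.ne_zero, false_or]

end ClearedSystematicPart

section Degree

variable {R σ ι : Type*} [CommRing R] [Fintype ι] [DecidableEq ι] {k r : ℕ} {s : σ}

theorem degreeOf_det_le {M : Matrix ι ι (MvPolynomial σ R)} {d : ι → ℕ}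
    (hM : ∀ i j, (M i j).degreeOf s ≤ d i) : M.det.degreeOf s ≤ ∑ i, d i := by
  rw [← Matrix.det_transpose, Matrix.det_apply]
  refine (MvPolynomial.degreeOf_sum_le _ _ _).trans (Finset.sup_le fun τ _ => ?_)
  have hsign (p : MvPolynomial σ R) : (Equiv.Perm.sign τ • p).degreeOf s = p.degreeOf s := by
    rcases Int.units_eq_one_or (Equiv.Perm.sign τ) with h | h <;>
      simp [h, MvPolynomial.degreeOf_neg]
  rw [hsign]
  exact (MvPolynomial.degreeOf_prod_le _ _ _).trans (Finset.sum_le_sum fun i _ => hM _ _)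

theorem degreeOf_clearedSystematicPart_le {G : Matrix (Fin k) (Fin (k + r)) (MvPolynomial σ R)}
    {d : Fin k → ℕ} (hG : ∀ i m, (G i m).degreeOf s ≤ d i) (i : Fin k) (j : Fin r) :
    (clearedSystematicPart G i j).degreeOf s ≤ ∑ i, d i := by
  rw [clearedSystematicPart_apply]
  refine degreeOf_det_le fun a b => ?_
  rw [Matrix.updateCol_apply]
  split_ifs
  · exact hG a _
  · exact hG a _

theorem degreeOf_inverseMinor_le {M : Matrix (Fin 3) (Fin 3) (MvPolynomial σ R)} {d : ℕ}
    (hM : ∀ i j, (M i j).degreeOf s ≤ d) : (inverseMinor M).degreeOf s ≤ 6 * d := by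
  refine (degreeOf_det_le (d := fun _ => d + d) fun i j => ?_).trans_eq ?_
  · exact (MvPolynomial.degreeOf_mul_le _ _ _).trans (add_le_add (hM _ _) (hM _ _))
  · rw [Fin.sum_const, smul_eq_mul]
    ring

end Degree

section PolynomialFamily

variable {F σ : Type*} [Field F] [DecidableEq F] {k r : ℕ}

theorem exists_polynomial_eval_eq_zero_of_isGRS
    {G : Matrix (Fin k) (Fin (k + r)) (MvPolynomial σ F)} (hk : 2 ≤ k) (hr : 2 ≤ r)
    {g : Fin (k + r) → F} (hg : Function.Injective g) {d : σ → Fin k → ℕ}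
    (hd : ∀ s i m, (G i m).degreeOf s ≤ d s i)
    (hG : ∀ η, Function.Injective (G.map (MvPolynomial.eval η)).vecMul)
    (hex : ∃ η, IsMDS (rowSpace (G.map (MvPolynomial.eval η))) ∧
      ¬ IsGRS (rowSpace (G.map (MvPolynomial.eval η)))) :
    ∃ P : MvPolynomial σ F, P ≠ 0 ∧ (∀ s, P.degreeOf s ≤ 6 * ∑ i, d s i) ∧
      ∀ η, IsMDS (rowSpace (G.map (MvPolynomial.eval η))) →
        IsGRS (rowSpace (G.map (MvPolynomial.eval η))) → MvPolynomial.eval η P = 0 := by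
  have : Nontrivial (Fin k) := Fin.nontrivial_iff_two_le.2 hk
  have : Nontrivial (Fin r) := Fin.nontrivial_iff_two_le.2 hr
  obtain ⟨i₀, i₁, hi⟩ := exists_pair_ne (Fin k)
  obtain ⟨j₀, j₁, hj⟩ := exists_pair_ne (Fin r)
  let minor (i : Fin k) (j : Fin r) : MvPolynomial σ F :=
    inverseMinor ((clearedSystematicPart G).submatrix ![i₀, i₁, i] ![j₀, j₁, j])
  have hgrs_iff : ∀ η, IsMDS (rowSpace (G.map (MvPolynomial.eval η))) →
      (IsGRS (rowSpace (G.map (MvPolynomial.eval η))) ↔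
        ∀ i j, MvPolynomial.eval η (minor i j) = 0) := by
    intro η hmds
    simp only [isGRS_rowSpace_iff (hG η) hmds hg hi hj, minor, map_inverseMinor,
      ← map_clearedSystematicPart, Matrix.submatrix_map]
  obtain ⟨ηstar, hmds, hgrs⟩ := hex
  rw [hgrs_iff ηstar hmds] at hgrs
  push Not at hgrs
  obtain ⟨i, j, hij⟩ := hgrs
  refine ⟨minor i j, ne_zero_of_map hij, fun s => ?_, fun η hη h => (hgrs_iff η hη).1 h i j⟩
  exact degreeOf_inverseMinor_le fun _ _ => degreeOf_clearedSystematicPart_le (hd s) _ _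

end PolynomialFamily

section TwistedReedSolomon

variable {R S F : Type*} [CommRing R] [CommRing S] [Field F] {n k ℓ : ℕ}

/-- The generator matrix of the twisted Reed--Solomon code whose `i`-th row evaluates the twisted
polynomial with coefficient vector the `i`-th unit vector. The ring is arbitrary so that the twist
coefficients `η` can be the variables of a polynomial ring. -/
def twistedGenerator (α : Fin n → R) (t : Fin ℓ → ℕ) (h : Fin ℓ → Fin k) (η : Fin ℓ → R) :
    Matrix (Fin k) (Fin n) R :=
  Matrix.of fun i m => α m ^ (i : ℕ) + ∑ j, if h j = i then η j * α m ^ (k - 1 + t j) else 0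

theorem map_twistedGenerator (f : R →+* S) (α : Fin n → R) (t : Fin ℓ → ℕ) (h : Fin ℓ → Fin k)
    (η : Fin ℓ → R) :
    (twistedGenerator α t h η).map f = twistedGenerator (f ∘ α) t h (f ∘ η) := by
  ext i m
  simp [twistedGenerator, apply_ite f]

theorem map_eval_twistedGenerator (α : Fin n → R) (t : Fin ℓ → ℕ) (h : Fin ℓ → Fin k)
    (η : Fin ℓ → R) :
    (twistedGenerator (MvPolynomial.C ∘ α) t h MvPolynomial.X).map (MvPolynomial.eval η) =
      twistedGenerator α t h η := by
  rw [map_twistedGenerator]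
  congr 1 <;> ext <;> simp

theorem degreeOf_twistedGenerator_le [Nontrivial R] (α : Fin n → R) (t : Fin ℓ → ℕ)
    (h : Fin ℓ → Fin k) (s : Fin ℓ) (i : Fin k) (m : Fin n) :
    (twistedGenerator (MvPolynomial.C ∘ α) t h MvPolynomial.X i m).degreeOf s ≤
      if h s = i then 1 else 0 := by
  have hmonomial (a : R) (j : Fin ℓ) (e : ℕ) :
      (MvPolynomial.X j * MvPolynomial.C a ^ e).degreeOf s ≤ if s = j then 1 else 0 := by
    rw [← map_pow]
    refine (MvPolynomial.degreeOf_mul_C_le _ _ _).trans_eq ?_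
    rw [MvPolynomial.degreeOf_X]
  refine (MvPolynomial.degreeOf_add_le _ _ _).trans (max_le ?_ ?_)
  · rw [Function.comp_apply, ← map_pow, MvPolynomial.degreeOf_C]
    exact Nat.zero_le _
  · refine (MvPolynomial.degreeOf_sum_le _ _ _).trans (Finset.sup_le fun j _ => ?_)
    by_cases hj : h j = i
    · rw [if_pos hj]
      refine (hmonomial _ _ _).trans ?_
      obtain rfl | hsj := eq_or_ne s j
      · rw [if_pos rfl, if_pos hj]
      · rw [if_neg hsj]
        exact Nat.zero_le _
    · rw [if_neg hj, MvPolynomial.degreeOf_zero]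
      exact Nat.zero_le _

theorem vecMul_twistedGenerator (α : Fin n → F) (t : Fin ℓ → ℕ) (h : Fin ℓ → Fin k)
    (η : Fin ℓ → F) (f : Fin k → F) :
    Matrix.vecMul f (twistedGenerator α t h η) = evalMap α (twistedPoly t h η f) := by
  ext m
  simp only [Matrix.vecMul, dotProduct, twistedGenerator, Matrix.of_apply, evalMap,
    LinearMap.pi_apply, leval_apply, twistedPoly, eval_add, eval_finsetSum, eval_mul, eval_C,
    eval_pow, eval_X, mul_add, Finset.sum_add_distrib, Finset.mul_sum]
  rw [Finset.sum_comm]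
  congr 1
  refine Finset.sum_congr rfl fun j _ => ?_
  simp only [mul_ite, mul_zero, Finset.sum_ite_eq, Finset.mem_univ, if_true]
  ring

theorem twistedRSCode_eq_rowSpace (α : Fin n → F) (t : Fin ℓ → ℕ) (h : Fin ℓ → Fin k)
    (η : Fin ℓ → F) : twistedRSCode α t h η = rowSpace (twistedGenerator α t h η) := by
  ext x
  simp only [mem_rowSpace, vecMul_twistedGenerator]
  constructor
  · rintro ⟨_, ⟨f, rfl⟩, rfl⟩
    exact ⟨f, rfl⟩
  · rintro ⟨f, rfl⟩
    exact ⟨_, ⟨f, rfl⟩, rfl⟩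

theorem twistedPoly_mem_degreeLT (hkn : k ≤ n) {t : Fin ℓ → ℕ} (ht : ∀ j, t j ≤ n - k)
    (h : Fin ℓ → Fin k) (η : Fin ℓ → F) (f : Fin k → F) :
    twistedPoly t h η f ∈ degreeLT F n := by
  have hmonomial (a : F) {e : ℕ} (he : e < n) : C a * X ^ e ∈ degreeLT F n :=
    mem_degreeLT.2 ((degree_C_mul_X_pow_le e a).trans_lt (by exact_mod_cast he))
  refine add_mem (sum_mem fun i _ => hmonomial _ (i.2.trans_le hkn))
    (sum_mem fun j _ => hmonomial _ ?_)
  have := ht j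
  have := (h j).2
  omega

theorem coeff_twistedPoly {t : Fin ℓ → ℕ} (ht : ∀ j, 1 ≤ t j) (h : Fin ℓ → Fin k)
    (η : Fin ℓ → F) (f : Fin k → F) (i : Fin k) : (twistedPoly t h η f).coeff i = f i := by
  have htwist : ∀ j, (i : ℕ) ≠ k - 1 + t j := by
    intro j
    have := ht j
    omega
  simp only [twistedPoly, coeff_add, finsetSum_coeff, coeff_C_mul_X_pow, htwist, Fin.val_inj,
    if_false, Finset.sum_const_zero, add_zero, Finset.sum_ite_eq, Finset.mem_univ, if_true]

theorem vecMul_twistedGenerator_injective (hkn : k ≤ n) {α : Fin n → F}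
    (hα : Function.Injective α) {t : Fin ℓ → ℕ} (ht : ∀ j, 1 ≤ t j ∧ t j ≤ n - k)
    (h : Fin ℓ → Fin k) (η : Fin ℓ → F) : Function.Injective (twistedGenerator α t h η).vecMul := by
  intro f g hfg
  simp only [vecMul_twistedGenerator] at hfg
  have hpoly : twistedPoly t h η f = twistedPoly t h η g :=
    injOn_evalMap hα (twistedPoly_mem_degreeLT hkn (fun j => (ht j).2) h η f)
      (twistedPoly_mem_degreeLT hkn (fun j => (ht j).2) h η g) hfg
  ext i
  rw [← coeff_twistedPoly (fun j => (ht j).1) h η f, hpoly, coeff_twistedPoly fun j => (ht j).1]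

end TwistedReedSolomon

end TwistedRS

open TwistedRS in
theorem mainTheorem8_general {F : Type*} [Field F] [DecidableEq F]
    {n k ℓ : ℕ} (hk : 2 ≤ k) (hkn : k + 2 ≤ n) {α : Fin n → F} (hα : Function.Injective α)
    {t : Fin ℓ → ℕ} (ht : ∀ j, 1 ≤ t j ∧ t j ≤ n - k) (h : Fin ℓ → Fin k)
    (hex : ∃ ηstar : Fin ℓ → F,
      IsMDS (twistedRSCode α t h ηstar) ∧ ¬ IsGRS (twistedRSCode α t h ηstar)) :
    ∃ P : MvPolynomial (Fin ℓ) F, P ≠ 0 ∧ (∀ j, P.degreeOf j ≤ 6) ∧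
      ∀ η : Fin ℓ → F, IsMDS (twistedRSCode α t h η) → IsGRS (twistedRSCode α t h η) →
        MvPolynomial.eval η P = 0 := by
  obtain ⟨r, rfl⟩ := Nat.exists_eq_add_of_le (Nat.le_of_add_right_le hkn)
  have hgenerator := vecMul_twistedGenerator_injective (Nat.le_add_right k r) hα ht h
  simp only [twistedRSCode_eq_rowSpace, ← map_eval_twistedGenerator α] at hex hgenerator ⊢
  obtain ⟨P, hP, hdeg, hvanish⟩ := exists_polynomial_eval_eq_zero_of_isGRS hk (by omega) hα
    (degreeOf_twistedGenerator_le α t h) hgenerator hex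
  exact ⟨P, hP, fun j => by simpa using hdeg j, hvanish⟩

theorem mainTheorem8 {F : Type*} [Field F] [Finite F] [DecidableEq F]
    (n k ℓ : ℕ) (hℓ : 0 < ℓ) (hkn : k < n) (hmin : 3 ≤ min k (n - k))
    (α : Fin n → F) (hα : Function.Injective α)
    (t : Fin ℓ → ℕ) (ht : ∀ j, 1 ≤ t j ∧ t j ≤ n - k)
    (h : Fin ℓ → Fin k)
    (hth : Function.Injective fun j => (h j, t j))
    (hex : ∃ ηstar : Fin ℓ → F,
      TwistedRS.IsMDS (TwistedRS.twistedRSCode α t h ηstar) ∧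
        ¬ TwistedRS.IsGRS (TwistedRS.twistedRSCode α t h ηstar)) :
    ∃ P : MvPolynomial (Fin ℓ) F, P ≠ 0 ∧ (∀ j, P.degreeOf j ≤ 6) ∧
      ∀ η : Fin ℓ → F,
        TwistedRS.IsMDS (TwistedRS.twistedRSCode α t h η) →
        TwistedRS.IsGRS (TwistedRS.twistedRSCode α t h η) →
          MvPolynomial.eval η P = 0 :=
  mainTheorem8_general (by omega) (by omega) hα ht h hex
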